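/- Let $\mathcal{X},\mathcal{W},\mathcal{Y}_1,\dots,\mathcal{Y}_K,\mathcal{U}_1,\dots,\mathcal{U}_K$ be finite alphabets. Let $(X,Y_1,\dots,Y_K)$ have an arbitrary joint pmf on $\mathcal{X}\times\mathcal{Y}_1\times\cdots\times\mathcal{Y}_K$, and let $T(u_1,\dots,u_K\mid w)$ be an arbitrary conditional pmf (a broadcast channel with input alphabet $\mathcal{W}$ and output alphabet $\mathcal{U}_k$ at receiver $k$). For positive integers $n_s,n_c$ and non-negative integers $L_1,\dots,L_K$, an $(n_s,n_c,L_1,\dots,L_K)$ list code consists of an encoder $f:\mathcal{X}^{n_s}\to\mathcal{W}^{n_c}$ and, for each $k$, a list decoder $g_k:\mathcal{U}_k^{n_c}\times\mathcal{Y}_k^{n_s}\to\{\mathcal{L}\subseteq\mathcal{X}^{n_s}:|\mathcal{L}|=L_k\}$. Here $(\mathbf{X},\mathbf{Y}_1,\dots,\mathbf{Y}_K)$ consists of $n_s$ i.i.d. copies of $(X,Y_1,\dots,Y_K)$; the codeword $\mathbf{W}=f(\mathbf{X})$ is sent over the memoryless channel, so that, given $\mathbf{W}=\mathbf{w}$ (and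 the source and side information), the outputs equal $(\mathbf{u}_1,\dots,\mathbf{u}_K)$ with probability $\prod_{i=1}^{n_c}T(u_{1,i},\dots,u_{K,i}\mid w_i)$; and receiver $k$ forms the list $\mathcal{L}_k=g_k(\mathbf{U}_k,\mathbf{Y}_k)$. Let $\kappa>0$ be rational and let $\boldsymbol{D}=(D_1,\dots,D_K)$ with $D_k\ge 0$ for all $k$. Call $(\kappa,\boldsymbol{D})$ *achievable* if for every $\epsilon>0$ and all sufficiently large $n_s,n_c$ with $n_c/n_s=\kappa$ there is an $(n_s,n_c,L_1,\dots,L_K)$ list code with $$L_k\le 2^{n_sD_k}\quad\text{and}\quad \Pr[\mathbf{X}\notin\mathcal{L}_k]\le\epsilon\qquad\text{for all }k. \tag{1}$$ Call it *weakly achievable* if for every $\epsilon>0$ and every $N$ there is a list code satisfying (1) for some $n_s,n_c\ge N$ with $n_c/n_s=\kappa$. Entropy and mutual information are in bits, and for a pmf $P_W$ on $\mathcal{W}$ the quantity $I(W;U_k)$ is computed with $(W,U_1,\dots,U_K)\sim P_W(\cdot)T(\cdot\mid\cdot)$. **Lemma.** 1. If there is a pmf $P_W$ on $\mathcal{W}$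 with $D_k>\max\{H(X|Y_k)-\kappa I(W;U_k),\,0\}$ for all $k$, then $(\kappa,\boldsymbol{D})$ is achievable. 2. If $(\kappa,\boldsymbol{D})$ is achievable, then it is weakly achievable. 3. If $(\kappa,\boldsymbol{D})$ is weakly achievable, then there is a pmf $P_W$ on $\mathcal{W}$ with $D_k\ge\max\{H(X|Y_k)-\kappa I(W;U_k),\,0\}$ for all $k$. In particular, under either notion of achievability, the strict condition is sufficient and the non-strict condition is necessary. -/

import Mathlib

namespace SWList

/-- Conditional entropy `H(A|B) = -∑ p(a,b) log₂ (p(a,b) / p(b))`, in bits, of a pair `(A, B)` with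
joint pmf `p` on finite alphabets. -/
noncomputable def condEntropy {α β : Type*} [Fintype α] [Fintype β] (p : PMF (α × β)) : ℝ :=
  -∑ a, ∑ b, (p (a, b)).toReal *
    Real.logb 2 ((p (a, b)).toReal / (p.map Prod.snd b).toReal)

/-- Mutual information `I(A;B) = ∑ p(a,b) log₂ (p(a,b) / (p(a) p(b)))`, in bits, of a pair `(A, B)`
with joint pmf `p` on finite alphabets. -/
noncomputable def mutualInfo {α β : Type*} [Fintype α] [Fintype β] (p : PMF (α × β)) : ℝ :=
  ∑ a, ∑ b, (p (a, b)).toReal *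
    Real.logb 2 ((p (a, b)).toReal / ((p.map Prod.fst a).toReal * (p.map Prod.snd b).toReal))

section Model

variable {K : ℕ} {X W : Type*} {Y U : Fin K → Type*}

/-- The joint pmf of `(X, Y_k)` when `(X, Y_1, …, Y_K) ∼ P`. -/
noncomputable def sourcePair (P : PMF (X × (∀ k, Y k))) (k : Fin K) : PMF (X × Y k) :=
  P.map fun z => (z.1, z.2 k)

/-- The joint pmf of `(W, U_k)` when `(W, U_1, …, U_K) ∼ P_W(·) T(·|·)`. -/
noncomputable def channelPair (PW : PMF W) (T : W → PMF (∀ k, U k)) (k : Fin K) :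
    PMF (W × U k) :=
  PW.bind fun w => (T w).map fun u => (w, u k)

/-- An `(ns, nc, L_1, …, L_K)` list code: an encoder `X^ns → W^nc` and, for every receiver `k`, a list
decoder that maps the channel output in `U_k^nc` and the side information in `Y_k^ns` to a subset of
`X^ns` with exactly `L_k` elements. -/
structure ListCode (X W : Type*) (Y U : Fin K → Type*) (ns nc : ℕ) (L : Fin K → ℕ) where
  encode : (Fin ns → X) → (Fin nc → W)
  decode : ∀ k, (Fin nc → U k) → (Fin ns → Y k) → {S : Finset (Fin ns → X) // S.card = L k}

variable [Fintype X] [∀ k, Fintype (Y k)] [∀ k, Fintype (U k)]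

open Classical in
/-- The probability that the source word is not in the list of receiver `k`: the `ns`
source/side-information tuples `s i` are iid with pmf `P`, and given the codeword the channel outputs
`u j` follow the memoryless law `∏ T(u j | w j)`. -/
noncomputable def ListCode.errorProb {ns nc : ℕ} {L : Fin K → ℕ} (C : ListCode X W Y U ns nc L)
    (P : PMF (X × (∀ k, Y k))) (T : W → PMF (∀ k, U k)) (k : Fin K) : ℝ :=
  ∑ s : Fin ns → X × (∀ k, Y k), ∑ u : Fin nc → (∀ k, U k),
    if (fun i => (s i).1) ∈ (C.decode k (fun j => u j k) (fun i => (s i).2 k)).1 then 0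
    else (∏ i, (P (s i)).toReal) * ∏ j, (T (C.encode (fun i => (s i).1) j) (u j)).toReal

/-- At block lengths `ns`, `nc` there is a list code with list sizes `L_k ≤ 2^(ns D_k)` and error
probability at most `ε` at every receiver. -/
def HasGoodCode (P : PMF (X × (∀ k, Y k))) (T : W → PMF (∀ k, U k)) (D : Fin K → ℝ)
    (ε : ℝ) (ns nc : ℕ) : Prop :=
  ∃ (L : Fin K → ℕ) (C : ListCode X W Y U ns nc L),
    ∀ k, (L k : ℝ) ≤ (2 : ℝ) ^ ((ns : ℝ) * D k) ∧ C.errorProb P T k ≤ ε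

/-- `(κ, D)` is achievable: for every `ε > 0` there is a good list code at all sufficiently large
block lengths with `nc / ns = κ`. -/
def Achievable (P : PMF (X × (∀ k, Y k))) (T : W → PMF (∀ k, U k)) (κ : ℚ) (D : Fin K → ℝ) :
    Prop :=
  ∀ ε : ℝ, 0 < ε → ∃ N : ℕ, ∀ ns nc : ℕ, N ≤ ns → N ≤ nc → (nc : ℚ) / ns = κ →
    HasGoodCode P T D ε ns nc

/-- The weaker form of achievability: for every `ε > 0` there are good list codes at some arbitrarily
large block lengths with `nc / ns = κ`. -/
def WeaklyAchievable (P : PMF (X × (∀ k, Y k))) (T : W → PMF (∀ k, U k)) (κ : ℚ)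
    (D : Fin K → ℝ) : Prop :=
  ∀ ε : ℝ, 0 < ε → ∀ N : ℕ, ∃ ns nc : ℕ, N ≤ ns ∧ N ≤ nc ∧ (nc : ℚ) / ns = κ ∧
    HasGoodCode P T D ε ns nc

end Model

end SWList

namespace SWList

open Finset

/-! Converse. Gibbs' inequality is applied once per receiver, to the law of a whole block (source
word, side information, output) against a comparison law in which side information and output are
independent, the outputs are i.i.d. of law `outLaw V v`, and the source word is guessed from the
list. In nats this gives ns·H(X|Y) - nc·I ≤ log 2 + log L + Pr[error]·ns·log|X| (`converse_single`).
Here v is the law of a codeword symbol averaged over source words and positions: it depends on the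
encoder but not on the receiver. The simplex is compact and `info` is continuous on it, so the v's
of better and better codes accumulate at a single P_W satisfying all K inequalities.

Achievability. There is no binning: each source word independently receives a codeword with i.i.d.
symbols of law P_W, and receiver k lists the words whose `score` p(x|y)V(u|w)/q(u) reaches τ =
exp(-ns·a), with a strictly between H(X|Y) - κI and D_k (in nats). The log score of the sent word is
a sum of independent terms with mean -ns(H(X|Y) - κI), so by Chernoff it misses the threshold with
exponentially small probability (`sum_score_lt_le`). A wrong word has an independent codeword, so by
Markov it reaches τ with probability at most p(x|y)/τ (`sum_score_ge_le`); summed over x, the list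
overflows with probability at most 1/(τL). The codebook law ignores the receiver, so one codebook
serves all K. -/

/-! ### Sums against finite product laws -/

lemma sum_toReal {α : Type*} [Fintype α] (p : PMF α) : ∑ a, (p a).toReal = 1 := by
  rw [← ENNReal.toReal_sum fun a _ => p.apply_ne_top a, ← tsum_fintype (L := .unconditional α),
    p.tsum_coe, ENNReal.toReal_one]

open Classical in
lemma map_toReal {α β : Type*} [Fintype α] (p : PMF α) (f : α → β) (b : β) :
    (p.map f b).toReal = ∑ a, if f a = b then (p a).toReal else 0 := by
  rw [PMF.map_apply, tsum_fintype, ENNReal.toReal_sum]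
  · refine sum_congr rfl fun a _ => ?_
    by_cases h : f a = b
    · simp [h]
    · simp [h, Ne.symm h]
  · intro a _
    split_ifs
    · exact p.apply_ne_top a
    · simp

lemma sum_pi_prod {ι A R : Type*} [Fintype ι] [DecidableEq ι] [Fintype A] [CommSemiring R]
    (g : ι → A → R) : ∑ f : ι → A, ∏ i, g i (f i) = ∏ i, ∑ a, g i a := by
  rw [prod_univ_sum, Fintype.piFinset_univ]

lemma sum_pi_prod_map {ι A B : Type*} [Fintype ι] [DecidableEq ι] [Fintype A] [Fintype B]
    (P : ι → PMF A) (φ : A → B) (G : (ι → B) → ℝ) :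
    ∑ s : ι → A, (∏ i, (P i (s i)).toReal) * G (fun i => φ (s i)) =
      ∑ b : ι → B, (∏ i, ((P i).map φ (b i)).toReal) * G b := by
  classical
  simp_rw [map_toReal, ← sum_pi_prod, sum_mul]
  rw [sum_comm]
  refine sum_congr rfl fun s _ => ?_
  rw [Finset.sum_eq_single (fun i => φ (s i))]
  · simp
  · intro b _ hb
    obtain ⟨i, hi⟩ := Function.ne_iff.1 hb
    rw [prod_eq_zero (mem_univ i) (if_neg (Ne.symm hi)), zero_mul]
  · simp

lemma sum_pi_prod_mul_sum {ι A : Type*} [Fintype ι] [DecidableEq ι] [Fintype A]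
    (a h : ι → A → ℝ) (ha : ∀ i, ∑ x, a i x = 1) :
    ∑ f : ι → A, (∏ i, a i (f i)) * ∑ j, h j (f j) = ∑ j, ∑ x, a j x * h j x := by
  simp_rw [mul_sum]
  rw [sum_comm]
  refine sum_congr rfl fun j _ => ?_
  have key : ∀ f : ι → A, (∏ i, a i (f i)) * h j (f j) =
      ∏ i, (a i (f i) * if i = j then h j (f i) else 1) := by
    intro f
    rw [prod_mul_distrib]
    simp
  simp_rw [key]
  rw [sum_pi_prod (fun i x => a i x * if i = j then h j x else 1),
    prod_eq_single j]
  · simp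
  · intro i _ hi
    simp [hi, ha]
  · simp

/-- Independence of two distinct coordinates. In the random codebook the coordinates are the
codewords of the sent word and of a competitor. -/
lemma sum_pi_prod_mul_two {ι A : Type*} [Fintype ι] [DecidableEq ι] [Fintype A]
    (a : A → ℝ) (ha : ∑ x, a x = 1) (g h : A → ℝ) {i j : ι} (hij : i ≠ j) :
    ∑ f : ι → A, (∏ i, a (f i)) * (g (f i) * h (f j)) =
      (∑ x, a x * g x) * ∑ x, a x * h x := by
  have key : ∀ f : ι → A, (∏ i, a (f i)) * (g (f i) * h (f j)) =
      ∏ l, (a (f l) * ((if l = i then g (f l) else 1) * if l = j then h (f l) else 1)) := by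
    intro f
    rw [prod_mul_distrib, prod_mul_distrib]
    simp
  simp_rw [key]
  rw [sum_pi_prod (fun l x => a x * ((if l = i then g x else 1) * if l = j then h x else 1)),
    ← mul_prod_erase univ _ (mem_univ i),
    ← mul_prod_erase (univ.erase i) _ (mem_erase.2 ⟨hij.symm, mem_univ j⟩), prod_eq_one]
  · simp [hij, hij.symm]
  · intro l hl
    simp only [mem_erase] at hl
    simp [hl.1, hl.2.1, ha]

lemma sum_pi_prod_mul_one {ι A : Type*} [Fintype ι] [DecidableEq ι] [Fintype A]
    (a : A → ℝ) (ha : ∑ x, a x = 1) (g : A → ℝ) (i : ι) :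
    ∑ f : ι → A, (∏ i, a (f i)) * g (f i) = ∑ x, a x * g x := by
  have := sum_pi_prod_mul_sum (fun _ : ι => a) (fun j x => if j = i then g x else 0)
    fun _ => ha
  simpa [sum_ite_eq, Finset.sum_comm (s := (univ : Finset ι))] using this

lemma sum_pi_pair {ι A B : Type*} [Fintype ι] [DecidableEq ι] [Fintype A] [Fintype B]
    (G : (ι → A) → (ι → B) → ℝ) :
    ∑ z : ι → A × B, G (fun i => (z i).1) (fun i => (z i).2) = ∑ x, ∑ y, G x y := by
  rw [← Fintype.sum_prod_type']
  exact Fintype.sum_equiv (Equiv.arrowProdEquivProdArrow ι (fun _ => A) (fun _ => B)) _ _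
    fun _ => rfl

/-! ### Reduction to a single receiver -/

section Model

variable {K : ℕ} {X W : Type*} {Y U : Fin K → Type*}

/-- The transition probabilities of the channel to receiver `k`. -/
noncomputable def chan (T : W → PMF (∀ k, U k)) (k : Fin K) (w : W) (u : U k) : ℝ :=
  ((T w).map (fun t => t k) u).toReal

lemma chan_nonneg (T : W → PMF (∀ k, U k)) (k : Fin K) (w : W) (u : U k) :
    0 ≤ chan T k w u := ENNReal.toReal_nonneg

lemma sum_chan [∀ k, Fintype (U k)] (T : W → PMF (∀ k, U k)) (k : Fin K) (w : W) :
    ∑ u, chan T k w u = 1 := sum_toReal _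

variable [Fintype X] [∀ k, Fintype (Y k)] [∀ k, Fintype (U k)]

-- The error event of receiver k involves only (X, Y_k, U_k), so all other coordinates can be summed
-- out. Both directions then work with a two-terminal problem.
open Classical in
lemma ListCode.errorProb_eq {ns nc : ℕ} {L : Fin K → ℕ} (C : ListCode X W Y U ns nc L)
    (P : PMF (X × (∀ k, Y k))) (T : W → PMF (∀ k, U k)) (k : Fin K) :
    C.errorProb P T k = ∑ z : Fin ns → X × Y k, (∏ i, (sourcePair P k (z i)).toReal) *
      ∑ u : Fin nc → U k, (∏ j, chan T k (C.encode (fun i => (z i).1) j) (u j)) *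
        if (fun i => (z i).1) ∈ (C.decode k u (fun i => (z i).2)).1 then 0 else 1 := by
  have h := sum_pi_prod_map (fun _ : Fin ns => P) (fun z => (z.1, z.2 k)) (fun z =>
      ∑ u : Fin nc → U k, (∏ j, chan T k (C.encode (fun i => (z i).1) j) (u j)) *
        if (fun i => (z i).1) ∈ (C.decode k u (fun i => (z i).2)).1 then 0 else 1)
  unfold sourcePair
  rw [← h]
  unfold ListCode.errorProb
  refine sum_congr rfl fun s _ => ?_
  have h2 := sum_pi_prod_map (fun j => T (C.encode (fun i => (s i).1) j)) (fun t => t k)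
    (fun u => if (fun i => (s i).1) ∈ (C.decode k u (fun i => (s i).2 k)).1 then 0 else 1)
  unfold chan
  rw [← h2, mul_sum]
  refine sum_congr rfl fun u _ => ?_
  split_ifs <;> simp

end Model

/-! ### Mutual information of a channel matrix -/

/-- The output law of the channel matrix `V` when the input has law `v`. -/
noncomputable def outLaw {W U : Type*} [Fintype W] (V : W → U → ℝ) (v : W → ℝ) (u : U) : ℝ :=
  ∑ w, v w * V w u

/-- Mutual information, in nats, between input and output of the channel matrix `V` when the input
has law `v`. -/
noncomputable def info {W U : Type*} [Fintype W] [Fintype U] (V : W → U → ℝ) (v : W → ℝ) : ℝ :=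
  ∑ w, v w * ∑ u, V w u * Real.log (V w u / outLaw V v u)

lemma outLaw_nonneg {W U : Type*} [Fintype W] {V : W → U → ℝ} {v : W → ℝ}
    (hV : ∀ w u, 0 ≤ V w u) (hv : ∀ w, 0 ≤ v w) (u : U) : 0 ≤ outLaw V v u :=
  sum_nonneg fun w _ => mul_nonneg (hv w) (hV w u)

lemma outLaw_pos {W U : Type*} [Fintype W] {V : W → U → ℝ} {v : W → ℝ}
    (hV : ∀ w u, 0 ≤ V w u) (hv : ∀ w, 0 ≤ v w) {w : W} {u : U} (hw : 0 < v w)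
    (hu : 0 < V w u) : 0 < outLaw V v u :=
  sum_pos' (fun w _ => mul_nonneg (hv w) (hV w u)) ⟨w, mem_univ w, mul_pos hw hu⟩

lemma sum_outLaw {W U : Type*} [Fintype W] [Fintype U] {V : W → U → ℝ}
    (hV : ∀ w, ∑ u, V w u = 1) (v : W → ℝ) : ∑ u, outLaw V v u = ∑ w, v w := by
  unfold outLaw
  rw [sum_comm]
  simp [← mul_sum, hV]

/-- The logarithm of the quotient may be split because a pair (w, u) of positive weight has `outLaw
V v u > 0`, and pairs of weight zero contribute nothing. The form without quotients yields
continuity in `v`. -/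
lemma info_eq_sub {W U : Type*} [Fintype W] [Fintype U] {V : W → U → ℝ} {v : W → ℝ}
    (hV : ∀ w u, 0 ≤ V w u) (hv : ∀ w, 0 ≤ v w) :
    info V v = ∑ w, v w * ∑ u, V w u * Real.log (V w u) -
      ∑ u, outLaw V v u * Real.log (outLaw V v u) := by
  have h : ∑ u, outLaw V v u * Real.log (outLaw V v u) =
      ∑ w, v w * ∑ u, V w u * Real.log (outLaw V v u) := by
    simp_rw [mul_sum]
    rw [sum_comm]
    refine sum_congr rfl fun u _ => ?_
    conv_lhs => enter [1]; unfold outLaw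
    rw [sum_mul]
    exact sum_congr rfl fun w _ => by ring
  rw [h, info, ← sum_sub_distrib]
  refine sum_congr rfl fun w _ => ?_
  rw [← mul_sub, ← sum_sub_distrib]
  rcases (hv w).eq_or_lt with h0 | h0
  · simp [← h0]
  congr 1
  refine sum_congr rfl fun u _ => ?_
  rcases (hV w u).eq_or_lt with h1 | h1
  · simp [← h1]
  rw [Real.log_div h1.ne' (outLaw_pos hV hv h0 h1).ne', mul_sub]

lemma continuousOn_info {W U : Type*} [Fintype W] [Fintype U] {V : W → U → ℝ}
    (hV : ∀ w u, 0 ≤ V w u) : ContinuousOn (info V) (stdSimplex ℝ W) := by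
  have h : Continuous fun v : W → ℝ => ∑ w, v w * ∑ u, V w u * Real.log (V w u) -
      ∑ u, outLaw V v u * Real.log (outLaw V v u) := by
    refine Continuous.sub (by fun_prop) (continuous_finsetSum _ fun u _ => ?_)
    exact Real.continuous_mul_log.comp (by unfold outLaw; fun_prop)
  exact h.continuousOn.congr fun v hv => info_eq_sub hV hv.1

/-! ### Converse for one block and one receiver -/

lemma gibbs {Ω : Type*} [Fintype Ω] (P Q : Ω → ℝ) (hP : ∀ ω, 0 ≤ P ω) (hQ : ∀ ω, 0 ≤ Q ω)
    (hPs : ∑ ω, P ω = 1) (hQs : ∑ ω, Q ω ≤ 1) (hPQ : ∀ ω, 0 < P ω → 0 < Q ω) :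
    ∑ ω, P ω * Real.log (Q ω / P ω) ≤ 0 := by
  have : ∀ ω, P ω * Real.log (Q ω / P ω) ≤ Q ω - P ω := by
    intro ω
    rcases (hP ω).eq_or_lt with h | h
    · simp [← h, hQ]
    · have := Real.log_le_sub_one_of_pos (div_pos (hPQ ω h) h)
      calc P ω * Real.log (Q ω / P ω) ≤ P ω * (Q ω / P ω - 1) := by gcongr
        _ = Q ω - P ω := by field_simp
  calc _ ≤ ∑ ω, (Q ω - P ω) := sum_le_sum fun ω _ => this ω
    _ ≤ 0 := by rw [sum_sub_distrib]; linarith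

lemma pos_of_prod_pos {ι : Type*} [Fintype ι] {g : ι → ℝ} (hg : ∀ i, 0 ≤ g i)
    (h : 0 < ∏ i, g i) (i : ι) : 0 < g i :=
  (hg i).lt_of_ne' fun h0 => h.ne' (prod_eq_zero (mem_univ i) h0)

open Classical in
/-- Fano-type converse for one receiver: `v` is the average input law of the codeword symbols. -/
lemma converse_single {X Y W U : Type*} [Fintype X] [Fintype Y] [Fintype W] [Fintype U]
    [Nonempty X] (p : X × Y → ℝ) (hp : ∀ z, 0 ≤ p z) (hps : ∑ z, p z = 1)
    (V : W → U → ℝ) (hV : ∀ w u, 0 ≤ V w u) (hVs : ∀ w, ∑ u, V w u = 1)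
    {ns nc L : ℕ} (hL : 1 ≤ L) (enc : (Fin ns → X) → (Fin nc → W))
    (dec : (Fin nc → U) → (Fin ns → Y) → Finset (Fin ns → X)) (hdec : ∀ u y, (dec u y).card = L)
    (v : W → ℝ) (hv : ∀ w, 0 ≤ v w) (hvs : ∑ w, v w = 1)
    (hvenc : ∀ w, nc * v w = ∑ z : Fin ns → X × Y, (∏ i, p (z i)) *
      ∑ j, if enc (fun i => (z i).1) j = w then 1 else 0) :
    ns * (-∑ z, p z * Real.log (p z / ∑ x, p (x, z.2))) - nc * info V v ≤
      Real.log 2 + Real.log L + (∑ z : Fin ns → X × Y, (∏ i, p (z i)) *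
        ∑ u : Fin nc → U, (∏ j, V (enc (fun i => (z i).1) j) (u j)) *
          if (fun i => (z i).1) ∈ dec u (fun i => (z i).2) then 0 else 1) *
        (ns * Real.log (Fintype.card X)) := by
  set pY : Y → ℝ := fun y => ∑ x, p (x, y) with hpY
  have hpY0 : ∀ y, 0 ≤ pY y := fun y => sum_nonneg fun x _ => hp _
  have hpYpos : ∀ z, 0 < p z → 0 < pY z.2 := fun z hz =>
    sum_pos' (fun x _ => hp _) ⟨z.1, mem_univ _, hz⟩
  have hpYs : ∑ y, pY y = 1 := by
    rw [← hps, Fintype.sum_prod_type, sum_comm]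
  have hLpos : (0 : ℝ) < L := by exact_mod_cast hL
  have hXpos : (0 : ℝ) < Fintype.card X := by exact_mod_cast Fintype.card_pos
  -- Guess of the source word: half uniform on the list, half uniform on all words. The first half
  -- gives probability at least 1/(2L) to a listed word; the second keeps `r` positive and costs log
  -- 2 + ns·log|X| on an error.
  set r : (Fin ns → X) → (Fin ns → Y) → (Fin nc → U) → ℝ := fun x y u =>
    (1 / 2) * (if x ∈ dec u y then 1 / (L : ℝ) else 0) + (1 / 2) * (1 / (Fintype.card X : ℝ) ^ ns)
    with hr
  have hr0 : ∀ x y u, 0 < r x y u := by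
    intro x y u
    simp only [hr]
    refine add_pos_of_nonneg_of_pos ?_ (by positivity)
    split_ifs <;> positivity
  have hrs : ∀ y u, ∑ x, r x y u = 1 := by
    intro y u
    simp only [hr]
    rw [sum_add_distrib, ← mul_sum, ← mul_sum, ← sum_filter, sum_const, sum_const,
      filter_mem_eq_inter, univ_inter, hdec, card_univ, Fintype.card_fun, Fintype.card_fin]
    simp only [nsmul_eq_mul]
    push_cast
    field_simp
    norm_num
  have hq0 := outLaw_nonneg hV hv
  set PP : (Fin ns → X × Y) × (Fin nc → U) → ℝ := fun ω =>
    (∏ i, p (ω.1 i)) * ∏ j, V (enc (fun i => (ω.1 i).1) j) (ω.2 j) with hPP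
  -- The same output law `outLaw V v` is used at every position, so averaging over positions gives
  -- `info V v` exactly and concavity of mutual information is not needed.
  set Q : (Fin ns → X × Y) × (Fin nc → U) → ℝ := fun ω =>
    (∏ i, pY (ω.1 i).2) * (∏ j, outLaw V v (ω.2 j)) *
      r (fun i => (ω.1 i).1) (fun i => (ω.1 i).2) ω.2 with hQ
  have hp1 : ∑ z : Fin ns → X × Y, ∏ i, p (z i) = 1 := by
    rw [sum_pi_prod fun _ => p]; simp [hps]
  have hV1 : ∀ w : Fin nc → W, ∑ u : Fin nc → U, ∏ j, V (w j) (u j) = 1 := by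
    intro w
    rw [sum_pi_prod fun j => V (w j)]; simp [hVs]
  have hPP0 : ∀ ω, 0 ≤ PP ω := fun ω =>
    mul_nonneg (prod_nonneg fun i _ => hp _) (prod_nonneg fun j _ => hV _ _)
  have hPPs : ∑ ω, PP ω = 1 := by
    simp only [hPP]
    rw [Fintype.sum_prod_type]
    simp only [← mul_sum, hV1, mul_one, hp1]
  have hQ0 : ∀ ω, 0 ≤ Q ω := fun ω =>
    mul_nonneg (mul_nonneg (prod_nonneg fun i _ => hpY0 _) (prod_nonneg fun j _ => hq0 _))
      (hr0 _ _ _).le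
  have hQs : ∑ ω, Q ω ≤ 1 := by
    apply le_of_eq
    simp only [hQ]
    rw [Fintype.sum_prod_type, sum_comm]
    have : ∀ u : Fin nc → U, ∑ z : Fin ns → X × Y, (∏ i, pY (z i).2) *
        (∏ j, outLaw V v (u j)) * r (fun i => (z i).1) (fun i => (z i).2) u =
        ∏ j, outLaw V v (u j) := by
      intro u
      rw [sum_pi_pair (fun x y => (∏ i, pY (y i)) * (∏ j, outLaw V v (u j)) * r x y u), sum_comm]
      simp_rw [← mul_sum, hrs, mul_one, ← sum_mul]
      rw [sum_pi_prod fun _ => pY]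
      simp [hpYs]
    simp only [this]
    rw [sum_pi_prod fun _ => outLaw V v]
    simp [sum_outLaw hVs, hvs]
  -- `nc * v w` is the expected number of occurrences of w in the codeword, so any letter sent with
  -- positive probability has positive mass.
  have hvpos : ∀ z : Fin ns → X × Y, 0 < ∏ i, p (z i) → ∀ j, 0 < v (enc (fun i => (z i).1) j) := by
    intro z hz j
    have h : (0 : ℝ) < nc * v (enc (fun i => (z i).1) j) := by
      rw [hvenc]
      refine sum_pos' (fun z _ => mul_nonneg (prod_nonneg fun i _ => hp _)
        (sum_nonneg fun j _ => by split_ifs <;> simp)) ⟨z, mem_univ _, mul_pos hz ?_⟩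
      exact sum_pos' (fun j _ => by split_ifs <;> simp) ⟨j, mem_univ _, by simp⟩
    exact pos_of_mul_pos_right h (Nat.cast_nonneg _)
  have hcomp : ∀ ω, 0 < PP ω → (∀ i, 0 < p (ω.1 i)) ∧
      (∀ j, 0 < V (enc (fun i => (ω.1 i).1) j) (ω.2 j)) ∧
      ∀ j, 0 < outLaw V v (ω.2 j) := by
    intro ω hω
    have h1 : 0 < ∏ i, p (ω.1 i) :=
      pos_of_mul_pos_left hω (prod_nonneg fun j _ => hV _ _)
    have h2 : 0 < ∏ j, V (enc (fun i => (ω.1 i).1) j) (ω.2 j) :=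
      pos_of_mul_pos_right hω h1.le
    refine ⟨pos_of_prod_pos (fun i => hp _) h1, pos_of_prod_pos (fun j => hV _ _) h2, fun j => ?_⟩
    exact outLaw_pos hV hv (hvpos _ h1 j) (pos_of_prod_pos (fun j => hV _ _) h2 j)
  have hPQ : ∀ ω, 0 < PP ω → 0 < Q ω := by
    intro ω hω
    obtain ⟨h1, -, h3⟩ := hcomp ω hω
    exact mul_pos (mul_pos (prod_pos fun i _ => hpYpos _ (h1 i)) (prod_pos fun j _ => h3 j))
      (hr0 _ _ _)
  have hG := gibbs PP Q hPP0 hQ0 hPPs hQs hPQ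
  have hlow : ∀ ω, PP ω * (-(Real.log 2 + Real.log L) -
      (if (fun i => (ω.1 i).1) ∈ dec ω.2 (fun i => (ω.1 i).2) then 0 else 1) *
        (ns * Real.log (Fintype.card X)) - ∑ i, Real.log (p (ω.1 i) / pY (ω.1 i).2) -
        ∑ j, Real.log (V (enc (fun i => (ω.1 i).1) j) (ω.2 j) / outLaw V v (ω.2 j))) ≤
      PP ω * Real.log (Q ω / PP ω) := by
    intro ω
    rcases (hPP0 ω).eq_or_lt with h0 | h0
    · simp [← h0]
    refine mul_le_mul_of_nonneg_left ?_ (hPP0 ω)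
    obtain ⟨h1, h2, h3⟩ := hcomp ω h0
    have e1 : Real.log (PP ω) = ∑ i, Real.log (p (ω.1 i)) +
        ∑ j, Real.log (V (enc (fun i => (ω.1 i).1) j) (ω.2 j)) := by
      rw [hPP, Real.log_mul (prod_pos fun i _ => h1 i).ne' (prod_pos fun j _ => h2 j).ne',
        Real.log_prod fun i _ => (h1 i).ne', Real.log_prod fun j _ => (h2 j).ne']
    have e2 : Real.log (Q ω) = ∑ i, Real.log (pY (ω.1 i).2) + ∑ j, Real.log (outLaw V v (ω.2 j)) +
        Real.log (r (fun i => (ω.1 i).1) (fun i => (ω.1 i).2) ω.2) := by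
      have h4 : ∀ i, pY (ω.1 i).2 ≠ 0 := fun i => (hpYpos _ (h1 i)).ne'
      rw [hQ, Real.log_mul (mul_ne_zero (prod_ne_zero_iff.2 fun i _ => h4 i)
        (prod_pos fun j _ => h3 j).ne') (hr0 _ _ _).ne', Real.log_mul
        (prod_ne_zero_iff.2 fun i _ => h4 i) (prod_pos fun j _ => h3 j).ne',
        Real.log_prod fun i _ => h4 i, Real.log_prod fun j _ => (h3 j).ne']
    have e3 : ∑ i, Real.log (p (ω.1 i) / pY (ω.1 i).2) =
        ∑ i, Real.log (p (ω.1 i)) - ∑ i, Real.log (pY (ω.1 i).2) := by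
      rw [← sum_sub_distrib]
      exact sum_congr rfl fun i _ => Real.log_div (h1 i).ne' (hpYpos _ (h1 i)).ne'
    have e4 : ∑ j, Real.log (V (enc (fun i => (ω.1 i).1) j) (ω.2 j) / outLaw V v (ω.2 j)) =
        ∑ j, Real.log (V (enc (fun i => (ω.1 i).1) j) (ω.2 j)) -
          ∑ j, Real.log (outLaw V v (ω.2 j)) := by
      rw [← sum_sub_distrib]
      exact sum_congr rfl fun j _ => Real.log_div (h2 j).ne' (h3 j).ne'
    rw [Real.log_div (hPQ ω h0).ne' h0.ne', e1, e2, e3, e4]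
    have e5 : -(Real.log 2 + Real.log L) -
        (if (fun i => (ω.1 i).1) ∈ dec ω.2 (fun i => (ω.1 i).2) then 0 else 1) *
        (ns * Real.log (Fintype.card X)) ≤
        Real.log (r (fun i => (ω.1 i).1) (fun i => (ω.1 i).2) ω.2) := by
      split_ifs with hmem
      · have : Real.log (1 / (2 * L)) ≤
            Real.log (r (fun i => (ω.1 i).1) (fun i => (ω.1 i).2) ω.2) := by
          refine Real.log_le_log (by positivity) ?_
          simp only [hr, if_pos hmem]
          have : 0 ≤ 1 / 2 * (1 / (Fintype.card X : ℝ) ^ ns) := by positivity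
          have h5 : (1 : ℝ) / (2 * L) = 1 / 2 * (1 / L) := by field_simp
          linarith
        rw [one_div, Real.log_inv, Real.log_mul two_ne_zero hLpos.ne'] at this
        linarith
      · simp only [hr, if_neg hmem]
        have hL0 : 0 ≤ Real.log L := Real.log_natCast_nonneg L
        rw [mul_zero, zero_add, Real.log_mul (by positivity)
          (by positivity), one_div, one_div, Real.log_inv, Real.log_inv, Real.log_pow]
        linarith
    linarith
  have hsum := (sum_le_sum fun ω (_ : ω ∈ univ) => hlow ω).trans hG
  have s1 : ∑ ω, PP ω * ∑ i, Real.log (p (ω.1 i) / pY (ω.1 i).2) =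
      ns * ∑ z, p z * Real.log (p z / pY z.2) := by
    simp only [hPP]
    rw [Fintype.sum_prod_type]
    simp only [mul_right_comm (∏ i, p _), ← mul_sum, hV1, mul_one]
    rw [sum_pi_prod_mul_sum (fun _ : Fin ns => p) (fun _ z => Real.log (p z / pY z.2))
      fun _ => hps]
    simp
  -- Group the positions by their letter w: each contributes the divergence of `V w` from `outLaw V
  -- v`, and the expected count of w is `nc * v w`.
  have s2 : ∑ ω, PP ω * ∑ j, Real.log (V (enc (fun i => (ω.1 i).1) j) (ω.2 j) /
      outLaw V v (ω.2 j)) = nc * info V v := by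
    simp only [hPP]
    rw [Fintype.sum_prod_type]
    simp only [mul_assoc, ← mul_sum]
    have : ∀ z : Fin ns → X × Y, ∑ u : Fin nc → U,
        (∏ j, V (enc (fun i => (z i).1) j) (u j)) *
          ∑ j, Real.log (V (enc (fun i => (z i).1) j) (u j) / outLaw V v (u j)) =
        ∑ w, (∑ j, if enc (fun i => (z i).1) j = w then 1 else 0) *
          ∑ u, V w u * Real.log (V w u / outLaw V v u) := by
      intro z
      rw [sum_pi_prod_mul_sum (fun j => V (enc (fun i => (z i).1) j))
        (fun j u => Real.log (V (enc (fun i => (z i).1) j) u / outLaw V v u)) fun _ => hVs _]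
      simp_rw [sum_mul]
      symm
      rw [sum_comm]
      exact sum_congr rfl fun j _ => by simp
    simp only [this]
    rw [info, mul_sum]
    simp_rw [← mul_assoc, hvenc, sum_mul, mul_sum]
    rw [sum_comm]
    refine sum_congr rfl fun w _ => sum_congr rfl fun z _ => ?_
    simp only [sum_mul, mul_assoc]
    exact sum_comm
  have s3 : ∑ ω, PP ω * (if (fun i => (ω.1 i).1) ∈ dec ω.2 (fun i => (ω.1 i).2) then 0 else 1) =
      ∑ z : Fin ns → X × Y, (∏ i, p (z i)) *
        ∑ u : Fin nc → U, (∏ j, V (enc (fun i => (z i).1) j) (u j)) *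
          if (fun i => (z i).1) ∈ dec u (fun i => (z i).2) then 0 else 1 := by
    simp only [hPP]
    rw [Fintype.sum_prod_type]
    simp only [mul_assoc, ← mul_sum]
  simp only [mul_sub, sum_sub_distrib, ← mul_assoc, ← sum_mul, hPPs, s1, s2, s3] at hsum
  linarith

/-! ### Conversion to bits and the limiting input law -/

lemma condEntropy_eq {α β : Type*} [Fintype α] [Fintype β] (p : PMF (α × β)) :
    condEntropy p = (-∑ z, (p z).toReal *
      Real.log ((p z).toReal / ∑ x, (p (x, z.2)).toReal)) / Real.log 2 := by
  classical
  have h : ∀ b, (p.map Prod.snd b).toReal = ∑ x, (p (x, b)).toReal := by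
    intro b
    rw [map_toReal, Fintype.sum_prod_type]
    simp
  unfold condEntropy
  rw [neg_div, Fintype.sum_prod_type, sum_div]
  simp_rw [sum_div, h, Real.logb, mul_div_assoc]

section Model

variable {K : ℕ} {X W : Type*} {Y U : Fin K → Type*}

lemma channelPair_apply_toReal [Fintype W] [∀ k, Fintype (U k)] (PW : PMF W)
    (T : W → PMF (∀ k, U k)) (k : Fin K) (w : W) (u : U k) :
    (channelPair PW T k (w, u)).toReal = (PW w).toReal * chan T k w u := by
  classical
  unfold channelPair chan
  rw [PMF.bind_apply, tsum_fintype, sum_eq_single w]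
  · rw [ENNReal.toReal_mul, map_toReal, map_toReal]
    simp
  · intro w' _ hw
    have : ((T w').map fun u => (w', u k)) (w, u) = 0 := by
      rw [PMF.map_apply]
      simp [hw.symm]
    rw [this, mul_zero]
  · simp

lemma mutualInfo_channelPair [Fintype W] [∀ k, Fintype (U k)] (PW : PMF W)
    (T : W → PMF (∀ k, U k)) (k : Fin K) :
    mutualInfo (channelPair PW T k) =
      info (chan T k) (fun w => (PW w).toReal) / Real.log 2 := by
  classical
  have h1 : ∀ w, ((channelPair PW T k).map Prod.fst w).toReal = (PW w).toReal := by
    intro w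
    rw [map_toReal, Fintype.sum_prod_type, sum_eq_single w]
    · simp [channelPair_apply_toReal, ← mul_sum, sum_chan]
    · intro w' _ hw
      simp [hw]
    · simp
  have h2 : ∀ u, ((channelPair PW T k).map Prod.snd u).toReal =
      outLaw (chan T k) (fun w => (PW w).toReal) u := by
    intro u
    rw [map_toReal, Fintype.sum_prod_type, outLaw]
    simp [channelPair_apply_toReal]
  unfold mutualInfo info
  rw [sum_div]
  refine sum_congr rfl fun w _ => ?_
  rw [mul_sum, sum_div]
  refine sum_congr rfl fun u _ => ?_
  rw [h1, h2, channelPair_apply_toReal, Real.logb]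
  by_cases h0 : (PW w).toReal = 0
  · simp [h0]
  rw [mul_div_mul_left _ _ h0]
  ring

lemma exists_pmf_of_mem_stdSimplex [Fintype W] {v : W → ℝ} (hv : v ∈ stdSimplex ℝ W) :
    ∃ PW : PMF W, (fun w => (PW w).toReal) = v := by
  refine ⟨PMF.ofFintype (fun w => ENNReal.ofReal (v w)) ?_, ?_⟩
  · rw [← ENNReal.ofReal_sum_of_nonneg fun w _ => hv.1 w, hv.2, ENNReal.ofReal_one]
  · funext w
    simp [ENNReal.toReal_ofReal (hv.1 w)]

variable [Fintype X] [∀ k, Fintype (Y k)] [∀ k, Fintype (U k)]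

/-- An error probability below one thus forces L_k ≥ 1, which the uniform law on the list in the
converse requires. -/
lemma ListCode.errorProb_eq_one_of_eq_zero {ns nc : ℕ} {L : Fin K → ℕ}
    (C : ListCode X W Y U ns nc L) (P : PMF (X × (∀ k, Y k))) (T : W → PMF (∀ k, U k))
    (k : Fin K) (hk : L k = 0) : C.errorProb P T k = 1 := by
  classical
  have h : ∀ u y, (C.decode k u y).1 = ∅ := fun u y =>
    card_eq_zero.1 ((C.decode k u y).2.trans hk)
  have hV : ∀ w : Fin nc → W, ∑ u : Fin nc → U k, ∏ j, chan T k (w j) (u j) = 1 := by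
    intro w
    rw [sum_pi_prod fun j => chan T k (w j)]; simp [sum_chan]
  rw [C.errorProb_eq]
  simp only [h, notMem_empty, if_false, mul_one, hV]
  rw [sum_pi_prod fun _ z => (sourcePair P k z).toReal]
  simp [sum_toReal]

lemma exists_input_of_hasGoodCode [Fintype W] (P : PMF (X × (∀ k, Y k))) (T : W → PMF (∀ k, U k))
    (D : Fin K → ℝ) {ε : ℝ} (hε : ε < 1) {ns nc : ℕ} (hnc : 0 < nc)
    (h : HasGoodCode P T D ε ns nc) :
    ∃ v ∈ stdSimplex ℝ W, ∀ k,
      ns * (condEntropy (sourcePair P k) * Real.log 2) - nc * info (chan T k) v ≤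
        Real.log 2 + ns * D k * Real.log 2 + ε * (ns * Real.log (Fintype.card X)) := by
  classical
  obtain ⟨L, C, hC⟩ := h
  have hX : Nonempty X := ⟨P.support_nonempty.some.1⟩
  have hnc' : (0 : ℝ) < nc := by exact_mod_cast hnc
  -- Law of the codeword symbol at a uniformly chosen position; no receiver index enters.
  set v : W → ℝ := fun w => (∑ s : Fin ns → X × (∀ k, Y k), (∏ i, (P (s i)).toReal) *
      ∑ j, if C.encode (fun i => (s i).1) j = w then 1 else 0) / nc with hv
  have hv0 : ∀ w, 0 ≤ v w := fun w => div_nonneg (sum_nonneg fun s _ => mul_nonneg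
    (prod_nonneg fun i _ => ENNReal.toReal_nonneg)
    (sum_nonneg fun j _ => by split_ifs <;> simp)) hnc'.le
  have hvs : ∑ w, v w = 1 := by
    simp only [hv]
    rw [← sum_div, sum_comm]
    have : ∀ s : Fin ns → X × (∀ k, Y k), ∑ w, (∏ i, (P (s i)).toReal) *
        ∑ j, (if C.encode (fun i => (s i).1) j = w then (1 : ℝ) else 0) =
        (∏ i, (P (s i)).toReal) * nc := by
      intro s
      rw [← mul_sum, sum_comm]
      simp
    simp only [this]
    rw [← sum_mul, sum_pi_prod fun _ z => (P z).toReal]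
    simp [sum_toReal, hnc'.ne']
  refine ⟨v, ⟨hv0, hvs⟩, fun k => ?_⟩
  obtain ⟨hLk, hek⟩ := hC k
  have hL1 : 1 ≤ L k := by
    by_contra hlt
    have := C.errorProb_eq_one_of_eq_zero P T k (by omega)
    linarith
  have key := converse_single (fun z => (sourcePair P k z).toReal)
    (fun _ => ENNReal.toReal_nonneg) (sum_toReal _) (chan T k) (chan_nonneg T k) (sum_chan T k)
    hL1 C.encode (fun u y => (C.decode k u y).1) (fun u y => (C.decode k u y).2) v hv0 hvs (by
      intro w
      have := sum_pi_prod_map (fun _ : Fin ns => P) (fun z => (z.1, z.2 k)) (fun z =>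
        ∑ j, if C.encode (fun i => (z i).1) j = w then 1 else 0)
      rw [sourcePair, ← this, hv]
      field_simp)
  rw [← C.errorProb_eq] at key
  have hlog : Real.log (L k) ≤ ns * D k * Real.log 2 := by
    rw [← Real.log_rpow two_pos]
    exact Real.log_le_log (by exact_mod_cast hL1) hLk
  have hcard : 0 ≤ ns * Real.log (Fintype.card X) :=
    mul_nonneg (Nat.cast_nonneg _) (Real.log_natCast_nonneg _)
  have hmul := mul_le_mul_of_nonneg_right hek hcard
  have hl2 : Real.log 2 ≠ 0 := (Real.log_pos one_lt_two).ne'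
  rw [condEntropy_eq, div_mul_cancel₀ _ hl2]
  linarith

theorem exists_pmf_of_weaklyAchievable [Fintype W] (P : PMF (X × (∀ k, Y k)))
    (T : W → PMF (∀ k, U k)) (κ : ℚ) (D : Fin K → ℝ) (hD : ∀ k, 0 ≤ D k) (h : WeaklyAchievable P T κ D) :
    ∃ PW : PMF W, ∀ k, D k ≥
      max (condEntropy (sourcePair P k) - (κ : ℝ) * mutualInfo (channelPair PW T k)) 0 := by
  have hl2 : 0 < Real.log 2 := Real.log_pos one_lt_two
  have hlX : 0 ≤ Real.log (Fintype.card X) := Real.log_natCast_nonneg _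
  have hseq : ∀ m : ℕ, ∃ v ∈ stdSimplex ℝ W, ∀ k,
      condEntropy (sourcePair P k) * Real.log 2 - κ * info (chan T k) v ≤
        D k * Real.log 2 + (Real.log 2 + Real.log (Fintype.card X)) * (1 / ((m : ℝ) + 1)) := by
    intro m
    have hm : (0 : ℝ) < m + 1 := by positivity
    -- With m + 2 the error level is below 1 already at m = 0.
    obtain ⟨ns, nc, hns, hnc, hr, hg⟩ := h (1 / ((m : ℝ) + 2)) (by positivity) (m + 1)
    have hns0 : (0 : ℝ) < ns := by exact_mod_cast (by omega : 0 < ns)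
    obtain ⟨v, hv, hk⟩ := exists_input_of_hasGoodCode P T D
      (by rw [div_lt_one (by positivity)]; linarith) (by omega : 0 < nc) hg
    refine ⟨v, hv, fun k => ?_⟩
    have hκr : (nc : ℝ) = κ * ns := by
      have : (nc : ℚ) = κ * ns := by
        rw [← hr, div_mul_cancel₀]
        exact_mod_cast hns0.ne'
      exact_mod_cast this
    have hmn : (m : ℝ) + 1 ≤ ns := by exact_mod_cast hns
    have h1 := hk k
    rw [hκr] at h1
    have h2 : Real.log 2 ≤ ns * (Real.log 2 * (1 / ((m : ℝ) + 1))) := by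
      rw [mul_one_div, mul_div_assoc', le_div_iff₀ hm]
      nlinarith
    have h3 : 1 / ((m : ℝ) + 2) * (ns * Real.log (Fintype.card X)) ≤
        1 / ((m : ℝ) + 1) * (ns * Real.log (Fintype.card X)) := by
      gcongr
      linarith
    refine le_of_mul_le_mul_left ?_ hns0
    linarith
  choose v hv hvk using hseq
  obtain ⟨v₀, hv₀, φ, hφ, hlim⟩ := (isCompact_stdSimplex ℝ W).tendsto_subseq hv
  obtain ⟨PW, hPW⟩ := exists_pmf_of_mem_stdSimplex hv₀
  refine ⟨PW, fun k => max_le ?_ (hD k)⟩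
  rw [mutualInfo_channelPair, hPW]
  have hinfo : Filter.Tendsto (fun m => info (chan T k) (v (φ m))) Filter.atTop
      (nhds (info (chan T k) v₀)) :=
    (continuousOn_info (chan_nonneg T k) v₀ hv₀).tendsto.comp
      (tendsto_nhdsWithin_iff.2 ⟨hlim, Filter.Eventually.of_forall fun m => hv _⟩)
  have hz : Filter.Tendsto (fun m => D k * Real.log 2 +
      (Real.log 2 + Real.log (Fintype.card X)) * (1 / ((φ m : ℝ) + 1))) Filter.atTop
      (nhds (D k * Real.log 2 + (Real.log 2 + Real.log (Fintype.card X)) * 0)) :=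
    ((tendsto_one_div_add_atTop_nhds_zero_nat.comp hφ.tendsto_atTop).const_mul _).const_add _
  have hfin := le_of_tendsto_of_tendsto' ((hinfo.const_mul (κ : ℝ)).const_sub
    (condEntropy (sourcePair P k) * Real.log 2)) hz fun m => hvk (φ m) k
  rw [mul_zero, add_zero] at hfin
  rw [← mul_le_mul_iff_of_pos_right hl2, sub_mul, mul_assoc, div_mul_cancel₀ _ hl2.ne']
  exact hfin

/-- Admissible block lengths exist beyond every bound: take common multiples of the denominator and
the numerator of κ, both positive. -/
theorem Achievable.weaklyAchievable {P : PMF (X × (∀ k, Y k))} {T : W → PMF (∀ k, U k)}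
    {κ : ℚ} (hκ : 0 < κ) {D : Fin K → ℝ} (h : Achievable P T κ D) :
    WeaklyAchievable P T κ D := by
  intro ε hε N
  obtain ⟨N₀, hN₀⟩ := h ε hε
  have hnum : 0 < κ.num.toNat := by
    have := Rat.num_pos.2 hκ
    omega
  have hr : ((κ.num.toNat * (N + N₀ + 1) : ℕ) : ℚ) / ((κ.den * (N + N₀ + 1) : ℕ) : ℚ) = κ := by
    have h1 : ((κ.num.toNat : ℕ) : ℚ) = (κ.num : ℚ) := by
      have : ((κ.num.toNat : ℕ) : ℤ) = κ.num := Int.toNat_of_nonneg (Rat.num_pos.2 hκ).le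
      exact_mod_cast this
    push_cast
    rw [mul_div_mul_right _ _ (by positivity), h1, Rat.num_div_den]
  have h1 : N + N₀ + 1 ≤ κ.den * (N + N₀ + 1) := Nat.le_mul_of_pos_left _ κ.den_pos
  have h2 : N + N₀ + 1 ≤ κ.num.toNat * (N + N₀ + 1) := Nat.le_mul_of_pos_left _ hnum
  exact ⟨_, _, by omega, by omega, hr, hN₀ _ _ (by omega) (by omega) hr⟩

end Model

/-! ### Achievability: Chernoff and averaging tools -/

/-- At t = 0 the sum equals 1 and its derivative is c minus the mean of f, which is negative. This
is the source of the exponential decay. -/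
lemma eventually_sum_mul_exp_lt_one {A : Type*} [Fintype A] (p f : A → ℝ) (hps : ∑ a, p a = 1)
    {c : ℝ} (hc : c < ∑ a, p a * f a) :
    ∀ᶠ t in nhdsWithin (0 : ℝ) (Set.Ioi 0), ∑ a, p a * Real.exp (-t * (f a - c)) < 1 := by
  have hd : HasDerivAt (fun t : ℝ => ∑ a, p a * Real.exp (-t * (f a - c)))
      (∑ a, p a * (Real.exp (-0 * (f a - c)) * (-1 * (f a - c)))) 0 := by
    refine HasDerivAt.fun_sum fun a _ => HasDerivAt.const_mul _ ?_
    exact (((hasDerivAt_id' (0 : ℝ)).neg).mul_const (f a - c)).exp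
  have hval : ∑ a, p a * (Real.exp (-0 * (f a - c)) * (-1 * (f a - c))) =
      c - ∑ a, p a * f a := by
    simp only [neg_zero, zero_mul, Real.exp_zero, one_mul]
    simp only [neg_one_mul, mul_neg, mul_sub, sum_neg_distrib, sum_sub_distrib, ← sum_mul, hps]
    ring
  rw [hval, hasDerivAt_iff_tendsto_slope] at hd
  have hneg := (hd.eventually_lt_const (sub_neg.2 hc)).filter_mono
    (nhdsWithin_mono 0 fun t (ht : 0 < t) => ht.ne')
  filter_upwards [hneg, self_mem_nhdsWithin] with t ht ht0
  rw [slope_def_field, sub_zero, div_neg_iff] at ht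
  have ht0' : (0 : ℝ) < t := ht0
  simp only [neg_zero, zero_mul, Real.exp_zero, mul_one, hps] at ht
  rcases ht with h | h <;> linarith [h.1, h.2]

lemma exists_le_of_weighted_sum_le {Ω : Type*} [Fintype Ω] (c g : Ω → ℝ) (hc : ∀ ω, 0 ≤ c ω)
    (hcs : ∑ ω, c ω = 1) {ε : ℝ} (h : ∑ ω, c ω * g ω ≤ ε) : ∃ ω, g ω ≤ ε := by
  by_contra! hlt
  have hex : ∃ ω, 0 < c ω := by
    by_contra! h0
    have : ∑ ω, c ω ≤ 0 := sum_nonpos fun ω _ => h0 ω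
    linarith
  obtain ⟨ω₀, hω₀⟩ := hex
  have : ∑ ω, c ω * ε < ∑ ω, c ω * g ω :=
    sum_lt_sum (fun ω _ => mul_le_mul_of_nonneg_left (hlt ω).le (hc ω))
      ⟨ω₀, mem_univ _, mul_lt_mul_of_pos_left (hlt ω₀) hω₀⟩
  rw [← sum_mul, hcs, one_mul] at this
  linarith

/-! ### Random codebooks and threshold scores -/

section Score

variable {X Y W U : Type*} [Fintype X] [Fintype W] {ns nc : ℕ}

/-- The score `p(x|y) V(u|w) / q(u)` of the source word `x` with codeword `w`, where `q` is the
output law. -/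
noncomputable def score (p : X × Y → ℝ) (V : W → U → ℝ) (v : W → ℝ) (x : Fin ns → X)
    (y : Fin ns → Y) (w : Fin nc → W) (u : Fin nc → U) : ℝ :=
  (∏ i, p (x i, y i) / ∑ x', p (x', y i)) * ∏ j, V (w j) (u j) / outLaw V v (u j)

open Classical in
/-- The source words whose score is at least `τ` under the codebook `F`. -/
noncomputable def candidates (p : X × Y → ℝ) (V : W → U → ℝ) (v : W → ℝ) (τ : ℝ)
    (F : (Fin ns → X) → (Fin nc → W)) (u : Fin nc → U) (y : Fin ns → Y) :
    Finset (Fin ns → X) :=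
  univ.filter fun x => τ ≤ score p V v x y (F x) u

variable {p : X × Y → ℝ} {V : W → U → ℝ} {v : W → ℝ}

lemma sum_codeword_mul_prod (u : Fin nc → U) :
    ∑ w : Fin nc → W, (∏ j, v (w j)) * ∏ j, V (w j) (u j) = ∏ j, outLaw V v (u j) := by
  simp_rw [← prod_mul_distrib]
  rw [sum_pi_prod fun j w => v w * V w (u j)]
  rfl

-- Markov's inequality: averaged over a codeword independent of u, the factor V(w|u-th symbols)/q
-- has mean at most 1, leaving p(x|y)/τ. The bound holds for each fixed u.
open Classical in
lemma sum_score_ge_le (hp : ∀ z, 0 ≤ p z) (hV : ∀ w u, 0 ≤ V w u) (hv : ∀ w, 0 ≤ v w) {τ : ℝ}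
    (hτ : 0 < τ) (x : Fin ns → X) (y : Fin ns → Y) (u : Fin nc → U) :
    ∑ w : Fin nc → W, (∏ j, v (w j)) * (if τ ≤ score p V v x y w u then 1 else 0) ≤
      (∏ i, p (x i, y i) / ∑ x', p (x', y i)) / τ := by
  have hA : 0 ≤ ∏ i, p (x i, y i) / ∑ x', p (x', y i) :=
    prod_nonneg fun i _ => div_nonneg (hp _) (sum_nonneg fun _ _ => hp _)
  have hsc : ∀ w : Fin nc → W, 0 ≤ score p V v x y w u := fun w => mul_nonneg hA
    (prod_nonneg fun j _ => div_nonneg (hV _ _) (outLaw_nonneg hV hv _))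
  calc _ ≤ ∑ w : Fin nc → W, (∏ j, v (w j)) * (score p V v x y w u / τ) := by
        refine sum_le_sum fun w _ => mul_le_mul_of_nonneg_left ?_ (prod_nonneg fun j _ => hv _)
        split_ifs with h
        · rwa [one_le_div hτ]
        · exact div_nonneg (hsc w) hτ.le
    _ = (∏ i, p (x i, y i) / ∑ x', p (x', y i)) / τ *
        ((∏ j, outLaw V v (u j)) / ∏ j, outLaw V v (u j)) := by
        rw [← sum_codeword_mul_prod u, sum_div, mul_sum]
        refine sum_congr rfl fun w _ => ?_
        rw [score, prod_div_distrib (s := (univ : Finset (Fin nc))), sum_codeword_mul_prod u]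
        ring
    -- The quotient is 1, or 0 by the convention for division by zero when some output symbol has
    -- mass zero.
    _ ≤ _ := mul_le_of_le_one_right (div_nonneg hA hτ.le) (div_self_le_one _)

lemma sum_posterior_le_one (hp : ∀ z, 0 ≤ p z) (y : Fin ns → Y) :
    ∑ x : Fin ns → X, ∏ i, p (x i, y i) / ∑ x', p (x', y i) ≤ 1 := by
  rw [sum_pi_prod fun i x => p (x, y i) / ∑ x', p (x', y i)]
  refine prod_le_one (fun i _ => sum_nonneg fun x _ => div_nonneg (hp _)
    (sum_nonneg fun _ _ => hp _)) fun i _ => ?_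
  rw [← sum_div]
  exact div_self_le_one _

variable [Fintype Y] [Fintype U]

lemma sum_prod_outLaw (hV : ∀ w, ∑ u, V w u = 1) (hvs : ∑ w, v w = 1) :
    ∑ u : Fin nc → U, ∏ j, outLaw V v (u j) = 1 := by
  rw [sum_pi_prod fun _ => outLaw V v]
  simp [sum_outLaw hV, hvs]

-- Chernoff bound: when the score is below τ, exp(-t(log score - ns·cs - nc·cc)) is at least 1, and
-- its expectation factors over source and channel positions.
open Classical in
lemma sum_score_lt_le (hp : ∀ z, 0 ≤ p z) (hV : ∀ w u, 0 ≤ V w u) (hv : ∀ w, 0 ≤ v w)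
    {τ t cs cc : ℝ} (ht : 0 < t) (hlog : Real.log τ ≤ ns * cs + nc * cc) :
    ∑ z : Fin ns → X × Y, (∏ i, p (z i)) * ∑ u : Fin nc → U, ∑ w : Fin nc → W,
      (∏ j, v (w j)) * ((∏ j, V (w j) (u j)) *
        (if τ ≤ score p V v (fun i => (z i).1) (fun i => (z i).2) w u then 0 else 1)) ≤
    (∑ z, p z * Real.exp (-t * (Real.log (p z / ∑ x', p (x', z.2)) - cs))) ^ ns *
      (∑ b : W × U, (v b.1 * V b.1 b.2) *
        Real.exp (-t * (Real.log (V b.1 b.2 / outLaw V v b.2) - cc))) ^ nc := by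
  set es : X × Y → ℝ := fun z => Real.exp (-t * (Real.log (p z / ∑ x', p (x', z.2)) - cs))
    with hes
  set ec : W → U → ℝ := fun w u => Real.exp (-t * (Real.log (V w u / outLaw V v u) - cc))
    with hec
  have key : ∀ (z : Fin ns → X × Y) (u : Fin nc → U) (w : Fin nc → W),
      (∏ i, p (z i)) * ((∏ j, v (w j)) * ((∏ j, V (w j) (u j)) *
        (if τ ≤ score p V v (fun i => (z i).1) (fun i => (z i).2) w u then 0 else 1))) ≤
      (∏ i, p (z i) * es (z i)) * ∏ j, (v (w j) * V (w j) (u j)) * ec (w j) (u j) := by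
    intro z u w
    have h1 : 0 ≤ ∏ i, p (z i) := prod_nonneg fun i _ => hp _
    have h2 : 0 ≤ ∏ j, v (w j) := prod_nonneg fun i _ => hv _
    have h3 : 0 ≤ ∏ j, V (w j) (u j) := prod_nonneg fun i _ => hV _ _
    have he : 0 < (∏ i, es (z i)) * ∏ j, ec (w j) (u j) :=
      mul_pos (prod_pos fun i _ => Real.exp_pos _) (prod_pos fun j _ => Real.exp_pos _)
    rw [prod_mul_distrib, prod_mul_distrib, prod_mul_distrib]
    suffices h : (∏ i, p (z i)) * (∏ j, v (w j)) * (∏ j, V (w j) (u j)) *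
        (if τ ≤ score p V v (fun i => (z i).1) (fun i => (z i).2) w u then 0 else 1) ≤
        (∏ i, p (z i)) * (∏ j, v (w j)) * (∏ j, V (w j) (u j)) *
          ((∏ i, es (z i)) * ∏ j, ec (w j) (u j)) by
      linarith
    -- Terms of probability zero are discarded first, so that every ratio in the score is positive
    -- and its logarithm splits.
    rcases h1.eq_or_lt with h1 | h1
    · simp [← h1]
    rcases h2.eq_or_lt with h2 | h2
    · simp [← h2]
    rcases h3.eq_or_lt with h3 | h3
    · simp [← h3]
    refine mul_le_mul_of_nonneg_left ?_ (by positivity)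
    split_ifs with hsc
    · exact he.le
    have p1 : ∀ i, 0 < p (z i) / ∑ x', p (x', (z i).2) := fun i => by
      have := pos_of_prod_pos (fun i => hp _) h1 i
      exact div_pos this (sum_pos' (fun x _ => hp _) ⟨(z i).1, mem_univ _, this⟩)
    have p2 : ∀ j, 0 < V (w j) (u j) / outLaw V v (u j) := fun j => by
      have a1 := pos_of_prod_pos (fun j => hV _ _) h3 j
      have a2 := pos_of_prod_pos (fun j => hv _) h2 j
      exact div_pos a1 (outLaw_pos hV hv a2 a1)
    have hs0 : 0 < score p V v (fun i => (z i).1) (fun i => (z i).2) w u :=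
      mul_pos (prod_pos fun i _ => p1 i) (prod_pos fun j _ => p2 j)
    have hl := (Real.log_lt_log hs0 (not_le.1 hsc)).le.trans hlog
    have hexp : Real.log (score p V v (fun i => (z i).1) (fun i => (z i).2) w u) =
        ∑ i, Real.log (p (z i) / ∑ x', p (x', (z i).2)) +
          ∑ j, Real.log (V (w j) (u j) / outLaw V v (u j)) := by
      rw [score, Real.log_mul (prod_pos fun i _ => p1 i).ne' (prod_pos fun j _ => p2 j).ne',
        Real.log_prod fun i _ => (p1 i).ne', Real.log_prod fun j _ => (p2 j).ne']
    simp only [hes, hec]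
    rw [← Real.exp_sum, ← Real.exp_sum, ← Real.exp_add, ← mul_sum, ← mul_sum, ← mul_add,
      sum_sub_distrib, sum_sub_distrib, Real.one_le_exp_iff]
    rw [hexp] at hl
    simp only [sum_const, card_univ, Fintype.card_fin, nsmul_eq_mul]
    nlinarith
  calc _ = ∑ z : Fin ns → X × Y, ∑ u : Fin nc → U, ∑ w : Fin nc → W,
      (∏ i, p (z i)) * ((∏ j, v (w j)) * ((∏ j, V (w j) (u j)) *
        (if τ ≤ score p V v (fun i => (z i).1) (fun i => (z i).2) w u then 0 else 1))) := by
        simp only [mul_sum]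
    _ ≤ ∑ z : Fin ns → X × Y, ∑ u : Fin nc → U, ∑ w : Fin nc → W,
      (∏ i, p (z i) * es (z i)) * ∏ j, (v (w j) * V (w j) (u j)) * ec (w j) (u j) :=
        sum_le_sum fun z _ => sum_le_sum fun u _ => sum_le_sum fun w _ => key z u w
    _ = _ := by
        simp only [← mul_sum]
        rw [← sum_mul, sum_pi_prod fun _ z => p z * es z, sum_comm, ← sum_pi_pair
          (fun (w : Fin nc → W) (u : Fin nc → U) => ∏ j, (v (w j) * V (w j) (u j)) *
            ec (w j) (u j))]
        beta_reduce
        rw [sum_pi_prod fun _ (b : W × U) => (v b.1 * V b.1 b.2) * ec b.1 b.2]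
        simp [hes, hec]

open Classical in
/-- The probability, for the codebook `F`, that the source word is not a candidate or that there are
more than `L` candidates. -/
noncomputable def failProb (p : X × Y → ℝ) (V : W → U → ℝ) (v : W → ℝ) (τ : ℝ) (L : ℕ)
    (F : (Fin ns → X) → (Fin nc → W)) : ℝ :=
  ∑ z : Fin ns → X × Y, (∏ i, p (z i)) *
    ∑ u : Fin nc → U, (∏ j, V (F (fun i => (z i).1) j) (u j)) *
      if (fun i => (z i).1) ∈ candidates p V v τ F u (fun i => (z i).2) ∧
        (candidates p V v τ F u (fun i => (z i).2)).card ≤ L then 0 else 1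

-- Either the sent word misses the threshold, or it is a candidate and the list overflows. In the
-- latter case at least L wrong words are candidates, so their number divided by L dominates the
-- indicator.
open Classical in
lemma failProb_le (hp : ∀ z, 0 ≤ p z) (hV : ∀ w u, 0 ≤ V w u) {τ : ℝ} {L : ℕ} (hL : 0 < L)
    (F : (Fin ns → X) → (Fin nc → W)) :
    failProb p V v τ L F ≤
      ∑ z : Fin ns → X × Y, (∏ i, p (z i)) *
        ∑ u : Fin nc → U, ((∏ j, V (F (fun i => (z i).1) j) (u j)) *
          (if τ ≤ score p V v (fun i => (z i).1) (fun i => (z i).2) (F fun i => (z i).1) u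
            then 0 else 1) +
          ∑ x' ∈ univ.erase (fun i => (z i).1), (∏ j, V (F (fun i => (z i).1) j) (u j)) *
            (if τ ≤ score p V v x' (fun i => (z i).2) (F x') u then 1 else 0) / L) := by
  refine sum_le_sum fun z _ => mul_le_mul_of_nonneg_left (sum_le_sum fun u _ => ?_)
    (prod_nonneg fun i _ => hp _)
  have hLr : (0 : ℝ) < L := by exact_mod_cast hL
  rw [← sum_div, ← mul_sum, mul_div_assoc, ← mul_add]
  refine mul_le_mul_of_nonneg_left ?_ (prod_nonneg fun j _ => hV _ _)
  set x : Fin ns → X := fun i => (z i).1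
  set y : Fin ns → Y := fun i => (z i).2
  have hnn : 0 ≤ (∑ x' ∈ univ.erase x,
      if τ ≤ score p V v x' y (F x') u then (1 : ℝ) else 0) / L :=
    div_nonneg (sum_nonneg fun _ _ => by split_ifs <;> simp) hLr.le
  by_cases hx : τ ≤ score p V v x y (F x) u
  · have hxS : x ∈ candidates p V v τ F u y := by simp [candidates, hx]
    by_cases hc : (candidates p V v τ F u y).card ≤ L
    · rw [if_pos ⟨hxS, hc⟩, if_pos hx, zero_add]
      exact hnn
    · rw [if_neg fun h => hc h.2, if_pos hx, zero_add, one_le_div hLr, sum_boole]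
      have : (univ.erase x).filter (fun x' => τ ≤ score p V v x' y (F x') u) =
          (candidates p V v τ F u y).erase x := by
        rw [candidates, filter_erase]
      rw [this, card_erase_of_mem hxS]
      exact_mod_cast (by omega : L ≤ (candidates p V v τ F u y).card - 1)
  · rw [if_neg hx]
    have : (if x ∈ candidates p V v τ F u y ∧ (candidates p V v τ F u y).card ≤ L
        then (0 : ℝ) else 1) ≤ 1 := by
      split_ifs <;> simp
    linarith

open Classical in
/-- The failure probability averaged over a codebook with independent symbols of law `v`. -/
lemma sum_codebook_failProb_le (hp : ∀ z, 0 ≤ p z) (hps : ∑ z, p z = 1)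
    (hV : ∀ w u, 0 ≤ V w u) (hVs : ∀ w, ∑ u, V w u = 1) (hv : ∀ w, 0 ≤ v w)
    (hvs : ∑ w, v w = 1) {τ : ℝ} (hτ : 0 < τ) {L : ℕ} (hL : 0 < L) {t cs cc : ℝ} (ht : 0 < t)
    (hlog : Real.log τ ≤ ns * cs + nc * cc) :
    ∑ F : (Fin ns → X) → (Fin nc → W), (∏ x, ∏ j, v (F x j)) * failProb p V v τ L F ≤
      (∑ z, p z * Real.exp (-t * (Real.log (p z / ∑ x', p (x', z.2)) - cs))) ^ ns *
        (∑ b : W × U, (v b.1 * V b.1 b.2) *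
          Real.exp (-t * (Real.log (V b.1 b.2 / outLaw V v b.2) - cc))) ^ nc + 1 / (τ * L) := by
  have hLr : (0 : ℝ) < L := by exact_mod_cast hL
  set cw : (Fin nc → W) → ℝ := fun w => ∏ j, v (w j) with hcw
  have hcw0 : ∀ w, 0 ≤ cw w := fun w => prod_nonneg fun j _ => hv _
  have hcws : ∑ w, cw w = 1 := by
    simp only [hcw]
    rw [sum_pi_prod fun _ => v]; simp [hvs]
  have hp1 : ∑ z : Fin ns → X × Y, ∏ i, p (z i) = 1 := by
    rw [sum_pi_prod fun _ => p]; simp [hps]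
  calc _ ≤ ∑ F : (Fin ns → X) → (Fin nc → W), (∏ x, cw (F x)) *
        ∑ z : Fin ns → X × Y, (∏ i, p (z i)) *
        ∑ u : Fin nc → U, ((∏ j, V (F (fun i => (z i).1) j) (u j)) *
          (if τ ≤ score p V v (fun i => (z i).1) (fun i => (z i).2) (F fun i => (z i).1) u
            then 0 else 1) +
          ∑ x' ∈ univ.erase (fun i => (z i).1), (∏ j, V (F (fun i => (z i).1) j) (u j)) *
            (if τ ≤ score p V v x' (fun i => (z i).2) (F x') u then 1 else 0) / L) :=
        sum_le_sum fun F _ => mul_le_mul_of_nonneg_left (failProb_le hp hV hL F)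
          (prod_nonneg fun x _ => hcw0 _)
    _ = ∑ z : Fin ns → X × Y, (∏ i, p (z i)) * ∑ u : Fin nc → U,
        ((∑ w, cw w * ((∏ j, V (w j) (u j)) *
          (if τ ≤ score p V v (fun i => (z i).1) (fun i => (z i).2) w u then 0 else 1))) +
        ∑ x' ∈ univ.erase (fun i => (z i).1), (∑ w, cw w * ∏ j, V (w j) (u j)) *
          (∑ w, cw w * (if τ ≤ score p V v x' (fun i => (z i).2) w u then 1 else 0)) / L) := by
        simp only [mul_sum (s := (univ : Finset (Fin ns → X × Y)))]
        rw [sum_comm]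
        refine sum_congr rfl fun z _ => ?_
        simp only [mul_left_comm _ (∏ i, p (z i)), ← mul_sum (a := ∏ i, p (z i))]
        congr 1
        simp only [mul_sum (s := (univ : Finset (Fin nc → U)))]
        rw [sum_comm]
        refine sum_congr rfl fun u _ => ?_
        simp only [mul_add, sum_add_distrib]
        congr 1
        · exact sum_pi_prod_mul_one cw hcws (fun w => (∏ j, V (w j) (u j)) *
            (if τ ≤ score p V v (fun i => (z i).1) (fun i => (z i).2) w u then 0 else 1)) _
        · simp only [mul_sum (s := univ.erase _)]
          rw [sum_comm]
          -- For x' distinct from the sent word the two codewords are independent, so the average of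
          -- the product splits.
          refine sum_congr rfl fun x' hx' => ?_
          rw [← sum_pi_prod_mul_two cw hcws (fun w => ∏ j, V (w j) (u j))
            (fun w => if τ ≤ score p V v x' (fun i => (z i).2) w u then 1 else 0)
            (ne_of_mem_erase hx').symm, sum_div]
          exact sum_congr rfl fun F _ => (mul_div_assoc _ _ _).symm
    _ ≤ ∑ z : Fin ns → X × Y, (∏ i, p (z i)) * (∑ u : Fin nc → U,
        (∑ w, cw w * ((∏ j, V (w j) (u j)) *
          (if τ ≤ score p V v (fun i => (z i).1) (fun i => (z i).2) w u then 0 else 1))) +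
        1 / (τ * L)) := by
        refine sum_le_sum fun z _ => mul_le_mul_of_nonneg_left ?_ (prod_nonneg fun i _ => hp _)
        rw [sum_add_distrib]
        refine add_le_add le_rfl ?_
        -- Averaged over the sent codeword, the output is i.i.d. of law `outLaw V v`; Markov for
        -- each competitor and the sum of posteriors then give 1/(τL).
        calc _ ≤ ∑ u : Fin nc → U, (∏ j, outLaw V v (u j)) * (1 / (τ * L)) := by
              refine sum_le_sum fun u _ => ?_
              have hq : 0 ≤ ∏ j, outLaw V v (u j) := prod_nonneg fun j _ => outLaw_nonneg hV hv _
              calc _ ≤ ∑ x' ∈ univ.erase (fun i => (z i).1), (∏ j, outLaw V v (u j)) *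
                    ((∏ i, p (x' i, (z i).2) / ∑ x'', p (x'', (z i).2)) / τ) / L := by
                    refine sum_le_sum fun x' _ => ?_
                    rw [sum_codeword_mul_prod u]
                    gcongr
                    exact sum_score_ge_le hp hV hv hτ x' _ u
                _ = (∏ j, outLaw V v (u j)) * ((∑ x' ∈ univ.erase (fun i => (z i).1),
                    ∏ i, p (x' i, (z i).2) / ∑ x'', p (x'', (z i).2)) / (τ * L)) := by
                    rw [sum_div, mul_sum]
                    refine sum_congr rfl fun x' _ => ?_
                    rw [← div_div, mul_div_assoc]
                _ ≤ _ := by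
                    gcongr
                    refine le_trans (sum_le_sum_of_subset_of_nonneg (erase_subset _ _)
                      fun x' _ _ => ?_) (sum_posterior_le_one hp fun i => (z i).2)
                    exact prod_nonneg fun i _ => div_nonneg (hp _) (sum_nonneg fun _ _ => hp _)
          _ = _ := by rw [← sum_mul, sum_prod_outLaw hVs hvs, one_mul]
    _ ≤ _ := by
        simp only [mul_add, sum_add_distrib]
        rw [← sum_mul, hp1, one_mul]
        exact add_le_add (sum_score_lt_le hp hV hv ht hlog) le_rfl

end Score

/-! ### From codebooks to list codes -/

/-- Decoders must output lists of exact size. A small candidate set is padded; an oversized one is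
replaced arbitrarily, since that event already counts as a failure. -/
lemma exists_card_eq_and_subset {β : Type*} [Fintype β] {L : ℕ} (hL : L ≤ Fintype.card β)
    (S : Finset β) : ∃ t : Finset β, t.card = L ∧ (S.card ≤ L → S ⊆ t) := by
  by_cases h : S.card ≤ L
  · obtain ⟨t, ht, hc⟩ := exists_superset_card_eq h hL
    exact ⟨t, hc, fun _ => ht⟩
  · obtain ⟨t, -, hc⟩ := exists_superset_card_eq (s := (∅ : Finset β)) (by simp) hL
    exact ⟨t, hc, fun h' => absurd h' h⟩

section Model

variable {K : ℕ} {X W : Type*} {Y U : Fin K → Type*}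
variable [Fintype X] [Fintype W] [∀ k, Fintype (Y k)] [∀ k, Fintype (U k)]

lemma hasGoodCode_of_failProb_le (P : PMF (X × (∀ k, Y k))) (T : W → PMF (∀ k, U k))
    (v : W → ℝ) (D : Fin K → ℝ) (ε : ℝ) {ns nc : ℕ} (τ : Fin K → ℝ)
    (F : (Fin ns → X) → (Fin nc → W))
    (h : ∀ k, failProb (fun z => (sourcePair P k z).toReal) (chan T k) v (τ k)
      ⌊(2 : ℝ) ^ ((ns : ℝ) * D k)⌋₊ F ≤ ε) :
    HasGoodCode P T D ε ns nc := by
  classical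
  -- The cap at |X|^ns is needed for lists of this size to exist.
  set L : Fin K → ℕ := fun k => min ⌊(2 : ℝ) ^ ((ns : ℝ) * D k)⌋₊ (Fintype.card (Fin ns → X))
    with hL
  have hdec := fun k (u : Fin nc → U k) (y : Fin ns → Y k) =>
    exists_card_eq_and_subset (min_le_right _ _ : L k ≤ Fintype.card (Fin ns → X))
      (candidates (fun z => (sourcePair P k z).toReal) (chan T k) v (τ k) F u y)
  choose dec hcard hsub using hdec
  refine ⟨L, ⟨F, fun k u y => ⟨dec k u y, hcard k u y⟩⟩, fun k => ⟨?_, ?_⟩⟩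
  · calc (L k : ℝ) ≤ ⌊(2 : ℝ) ^ ((ns : ℝ) * D k)⌋₊ := by exact_mod_cast min_le_left _ _
      _ ≤ _ := Nat.floor_le (by positivity)
  · refine le_trans ?_ (h k)
    rw [ListCode.errorProb_eq, failProb]
    refine sum_le_sum fun z _ => mul_le_mul_of_nonneg_left (sum_le_sum fun u _ =>
      mul_le_mul_of_nonneg_left ?_ (prod_nonneg fun j _ => chan_nonneg T k _ _))
      (prod_nonneg fun i _ => ENNReal.toReal_nonneg)
    split_ifs with h1 h2 h2
    · rfl
    · exact zero_le_one
    · exact absurd (hsub k u _ (le_min h2.2 (card_le_univ _)) h2.1) h1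
    · rfl

open Classical in
/-- Exponential decay of the average failure probability for one receiver. -/
lemma exists_exponential_bound (P : PMF (X × (∀ k, Y k))) (T : W → PMF (∀ k, U k))
    (PW : PMF W) {κ : ℝ} (hκ : 0 < κ) (k : Fin K) {d : ℝ} (hd : 0 ≤ d)
    (h : condEntropy (sourcePair P k) - κ * mutualInfo (channelPair PW T k) < d) :
    ∃ ρ : ℝ, 0 ≤ ρ ∧ ρ < 1 ∧ ∀ ns nc : ℕ, (nc : ℝ) = κ * ns → ∃ τ : ℝ,
      ∑ F : (Fin ns → X) → (Fin nc → W), (∏ x, ∏ j, (PW (F x j)).toReal) *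
        failProb (fun z => (sourcePair P k z).toReal) (chan T k) (fun w => (PW w).toReal) τ
          ⌊(2 : ℝ) ^ ((ns : ℝ) * d)⌋₊ F ≤ 3 * ρ ^ ns := by
  have hl2 : 0 < Real.log 2 := Real.log_pos one_lt_two
  set p : X × Y k → ℝ := fun z => (sourcePair P k z).toReal with hp
  set V := chan T k with hV
  set v : W → ℝ := fun w => (PW w).toReal with hv
  have hp0 : ∀ z, 0 ≤ p z := fun _ => ENNReal.toReal_nonneg
  have hv0 : ∀ w, 0 ≤ v w := fun _ => ENNReal.toReal_nonneg
  have hps : ∑ z, p z = 1 := sum_toReal _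
  have hvs : ∑ w, v w = 1 := sum_toReal _
  have hV0 := chan_nonneg T k
  have hVs := sum_chan T k
  set m : ℝ := ∑ z, p z * Real.log (p z / ∑ x, p (x, z.2)) with hm
  have hgap : -m - κ * info V v < d * Real.log 2 := by
    rw [condEntropy_eq, mutualInfo_channelPair, ← mul_lt_mul_iff_of_pos_right hl2, sub_mul,
      mul_assoc, div_mul_cancel₀ _ hl2.ne', div_mul_cancel₀ _ hl2.ne'] at h
    exact h
  obtain ⟨a, ha1, ha2⟩ := exists_between hgap
  -- Slack shared equally by all positions: with nc = κ·ns, this makes ns(m - δ) + nc(I - δ) equal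
  -- to -ns·a = log τ.
  set δ : ℝ := (a - (-m - κ * info V v)) / (1 + κ) with hδ
  have hδ0 : 0 < δ := div_pos (by linarith) (by linarith)
  have hδe : δ * (1 + κ) = a - (-m - κ * info V v) := div_mul_cancel₀ _ (by linarith)
  have hbs : ∑ b : W × U k, v b.1 * V b.1 b.2 = 1 := by
    rw [Fintype.sum_prod_type]
    simp [← mul_sum, hV, hVs, hvs]
  have hbi : ∑ b : W × U k, v b.1 * V b.1 b.2 * Real.log (V b.1 b.2 / outLaw V v b.2) =
      info V v := by
    rw [Fintype.sum_prod_type, info]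
    simp only [mul_sum, mul_assoc]
  have e1 := eventually_sum_mul_exp_lt_one p (fun z => Real.log (p z / ∑ x, p (x, z.2))) hps
    (c := m - δ) (by linarith)
  have e2 := eventually_sum_mul_exp_lt_one (fun b : W × U k => v b.1 * V b.1 b.2)
    (fun b => Real.log (V b.1 b.2 / outLaw V v b.2)) hbs (c := info V v - δ) (by linarith)
  obtain ⟨t, ⟨ht1, ht2⟩, ht0⟩ := ((e1.and e2).and self_mem_nhdsWithin).exists
  set A : ℝ := ∑ z, p z * Real.exp (-t * (Real.log (p z / ∑ x, p (x, z.2)) - (m - δ)))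
  set B : ℝ := ∑ b : W × U k, v b.1 * V b.1 b.2 *
    Real.exp (-t * (Real.log (V b.1 b.2 / outLaw V v b.2) - (info V v - δ)))
  have hA0 : 0 ≤ A := sum_nonneg fun z _ => mul_nonneg (hp0 z) (Real.exp_pos _).le
  have hB0 : 0 ≤ B := sum_nonneg fun b _ =>
    mul_nonneg (mul_nonneg (hv0 _) (hV0 _ _)) (Real.exp_pos _).le
  set r : ℝ := Real.exp (a - d * Real.log 2) with hr
  have hr1 : r < 1 := by
    rw [hr, Real.exp_lt_one_iff]
    linarith
  refine ⟨max A r, le_max_of_le_left hA0, max_lt ht1 hr1, fun ns nc hn => ?_⟩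
  refine ⟨Real.exp (-(ns * a)), ?_⟩
  have hpow1 : (1 : ℝ) ≤ (2 : ℝ) ^ ((ns : ℝ) * d) :=
    Real.one_le_rpow one_le_two (by positivity)
  have hfl : 0 < ⌊(2 : ℝ) ^ ((ns : ℝ) * d)⌋₊ := Nat.floor_pos.2 hpow1
  -- Since d ≥ 0 the power is at least 1, so rounding down loses at most a factor 2. Hence the 3 = 1
  -- + 2 in the bound.
  have hfl' : (2 : ℝ) ^ ((ns : ℝ) * d) / 2 ≤ ⌊(2 : ℝ) ^ ((ns : ℝ) * d)⌋₊ := by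
    have h1 := Nat.lt_floor_add_one ((2 : ℝ) ^ ((ns : ℝ) * d))
    have h2 : (1 : ℝ) ≤ ⌊(2 : ℝ) ^ ((ns : ℝ) * d)⌋₊ := by exact_mod_cast hfl
    linarith
  have hmain := sum_codebook_failProb_le (ns := ns) (nc := nc) hp0 hps hV0 hVs hv0 hvs
    (Real.exp_pos (-(ns * a))) hfl ht0 (cs := m - δ) (cc := info V v - δ) (by
      rw [Real.log_exp, hn]
      have : (ns : ℝ) * (δ * (1 + κ)) = ns * (a - (-m - κ * info V v)) := by rw [hδe]
      linarith)
  refine hmain.trans ?_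
  have b1 : A ^ ns * B ^ nc ≤ (max A r) ^ ns := calc
    A ^ ns * B ^ nc ≤ A ^ ns :=
      mul_le_of_le_one_right (pow_nonneg hA0 _) (pow_le_one₀ hB0 ht2.le)
    _ ≤ _ := pow_le_pow_left₀ hA0 (le_max_left _ _) _
  have b2 : 1 / (Real.exp (-(ns * a)) * (⌊(2 : ℝ) ^ ((ns : ℝ) * d)⌋₊ : ℝ)) ≤
      2 * (max A r) ^ ns := calc
    _ ≤ 1 / (Real.exp (-(ns * a)) * ((2 : ℝ) ^ ((ns : ℝ) * d) / 2)) := by gcongr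
    _ = 2 * r ^ ns := by
      have h2 : (2 : ℝ) ^ ((ns : ℝ) * d) = Real.exp (Real.log 2 * (ns * d)) :=
        Real.rpow_def_of_pos two_pos _
      rw [h2, hr, ← Real.exp_nat_mul, mul_div_assoc', ← Real.exp_add, one_div_div, div_eq_mul_inv,
        ← Real.exp_neg]
      ring_nf
    _ ≤ _ := by
      gcongr
      exact le_max_right _ _
  linarith

theorem achievable_of_pmf (P : PMF (X × (∀ k, Y k))) (T : W → PMF (∀ k, U k)) {κ : ℚ}
    (hκ : 0 < κ) (D : Fin K → ℝ) (PW : PMF W) (h : ∀ k, D k >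
      max (condEntropy (sourcePair P k) - (κ : ℝ) * mutualInfo (channelPair PW T k)) 0) :
    Achievable P T κ D := by
  classical
  intro ε hε
  have hκr : (0 : ℝ) < κ := by exact_mod_cast hκ
  choose ρ hρ0 hρ1 hρ using fun k => exists_exponential_bound P T PW hκr k
    ((le_max_right _ _).trans (h k).le) (lt_of_le_of_lt (le_max_left _ _) (h k))
  have hlim : Filter.Tendsto (fun n : ℕ => ∑ k, 3 * ρ k ^ n) Filter.atTop (nhds 0) := by
    have := tendsto_finsetSum (univ : Finset (Fin K)) fun k _ =>
      (tendsto_pow_atTop_nhds_zero_of_lt_one (hρ0 k) (hρ1 k)).const_mul 3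
    simpa using this
  obtain ⟨N, hN⟩ := Filter.eventually_atTop.1 (hlim.eventually_le_const hε)
  refine ⟨N + 1, fun ns nc hns _ hr => ?_⟩
  have hns0 : (ns : ℚ) ≠ 0 := by
    have : ns ≠ 0 := by omega
    exact_mod_cast this
  have hn : (nc : ℝ) = κ * ns := by
    have : (nc : ℚ) = κ * ns := by rw [← hr, div_mul_cancel₀ _ hns0]
    exact_mod_cast this
  choose τ hτ using fun k => hρ k ns nc hn
  set c : ((Fin ns → X) → (Fin nc → W)) → ℝ := fun F => ∏ x, ∏ j, (PW (F x j)).toReal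
  have hc0 : ∀ F, 0 ≤ c F := fun F =>
    prod_nonneg fun x _ => prod_nonneg fun j _ => ENNReal.toReal_nonneg
  have hcs : ∑ F, c F = 1 := by
    rw [sum_pi_prod fun _ (w : Fin nc → W) => ∏ j, (PW (w j)).toReal,
      sum_pi_prod fun _ w => (PW w).toReal]
    simp [sum_toReal]
  -- Averaging the sum of the K failure probabilities yields one codebook good for every receiver at
  -- once.
  obtain ⟨F, hF⟩ := exists_le_of_weighted_sum_le c (fun F => ∑ k,
    failProb (fun z => (sourcePair P k z).toReal) (chan T k) (fun w => (PW w).toReal) (τ k)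
      ⌊(2 : ℝ) ^ ((ns : ℝ) * D k)⌋₊ F) hc0 hcs (ε := ε) (by
    simp_rw [mul_sum]
    rw [sum_comm]
    exact (sum_le_sum fun k _ => hτ k).trans (hN ns (by omega)))
  refine hasGoodCode_of_failProb_le P T (fun w => (PW w).toReal) D ε τ F fun k => ?_
  refine le_trans (single_le_sum (f := fun k => failProb (fun z => (sourcePair P k z).toReal)
    (chan T k) (fun w => (PW w).toReal) (τ k) ⌊(2 : ℝ) ^ ((ns : ℝ) * D k)⌋₊ F)
    (fun k _ => ?_) (mem_univ k)) hF
  refine sum_nonneg fun z _ => mul_nonneg (prod_nonneg fun i _ => ENNReal.toReal_nonneg)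
    (sum_nonneg fun u _ => mul_nonneg (prod_nonneg fun j _ => chan_nonneg T k _ _) ?_)
  split_ifs <;> simp

end Model

end SWList

open SWList in
theorem lemma1 {K : ℕ} {X W : Type*} {Y U : Fin K → Type*}
    [Fintype X] [Fintype W] [∀ k, Fintype (Y k)] [∀ k, Fintype (U k)]
    (P : PMF (X × (∀ k, Y k))) (T : W → PMF (∀ k, U k))
    (κ : ℚ) (hκ : 0 < κ) (D : Fin K → ℝ) (hD : ∀ k, 0 ≤ D k) :
    ((∃ PW : PMF W, ∀ k, D k >
        max (condEntropy (sourcePair P k) - (κ : ℝ) * mutualInfo (channelPair PW T k)) 0) →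
      Achievable P T κ D) ∧
    (Achievable P T κ D → WeaklyAchievable P T κ D) ∧
    (WeaklyAchievable P T κ D →
      ∃ PW : PMF W, ∀ k, D k ≥
        max (condEntropy (sourcePair P k) - (κ : ℝ) * mutualInfo (channelPair PW T k)) 0) := by
  refine ⟨?_, fun h => h.weaklyAchievable hκ, exists_pmf_of_weaklyAchievable P T κ D hD⟩
  rintro ⟨PW, hPW⟩
  exact achievable_of_pmf P T hκ D PW hPW
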